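/- Let $K=\mathbb{Q}(t)$ with a fixed algebraic closure $\overline{K}$, let $d>0$ be an integer, and let $S\subseteq K[x]$ be a (possibly infinite) set of quadratic polynomials of the form $x^2+c$, where each $c$ satisfies all of the following conditions: 1. $c\in\mathbb{Z}[t]$ and the leading coefficient of $c$ is $\pm1$; 2. $\deg(c)=d$ (the same $d$ for all elements of $S$); 3. $\frac{d}{dt}\,\overline{c}=1$, where $\overline{c}\in(\mathbb{Z}/2\mathbb{Z})[t]$ is the reduction of $c$ modulo $2$. Given a sequence $\gamma=(\theta_1,\theta_2,\dots)$ of elements of $S$, put $\gamma_0^+=x$ and $\gamma_n^+=\theta_1\circ\theta_2\circ\cdots\circ\theta_n$ for $n\ge1$, and let $K_{\gamma,n}\subseteq\overline{K}$ be the splitting field of $\gamma_n^+$ over $K$. Let $G_{\gamma,K}=\varprojlim_n \mathrm{Gal}(K_{\gamma,n}/K)$ be the inverse limit with respect to the restriction maps. Let $T_\gamma$ be the preimage tree: the graph whose vertices are the $\alpha\in\overline{K}$ with $\gamma_m^+(\alpha)=0$ for some $m\ge0$ (the root of the tree being $0$), with an edge between $\alpha$ and $\theta_m(\alpha)$ whenever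 $m\geq 1$ and $\gamma_m^+(\alpha)=0$. The group $G_{\gamma,K}$ acts on $T_\gamma$ by its action on the roots of the $\gamma_m^+$. Then for every sequence $\gamma$ of elements of $S$ one has $G_{\gamma,K}=\mathrm{Aut}(T_\gamma)$; that is, the homomorphism $G_{\gamma,K}\to\mathrm{Aut}(T_\gamma)$ given by this action is bijective. -/

import Mathlib

open Polynomial

noncomputable section

namespace Arboreal

variable {K : Type*} [Field K]

/-- The right iterates `θ₁ ∘ θ₂ ∘ ⋯ ∘ θₙ` of a sequence of polynomials `γ = (θ₁, θ₂, …)`, where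
`γ i` stands for `θ_{i+1}`; the `0`-th iterate is the identity polynomial. -/
def rightIterate (γ : ℕ → K[X]) : ℕ → K[X]
  | 0 => X
  | n + 1 => (rightIterate γ n).comp (γ n)

/-- The splitting field of the `n`-th right iterate inside the algebraic closure of `K`. -/
def levelField (γ : ℕ → K[X]) (n : ℕ) : IntermediateField K (AlgebraicClosure K) :=
  IntermediateField.adjoin K ((rightIterate γ n).rootSet (AlgebraicClosure K))

instance levelField_normal (γ : ℕ → K[X]) (n : ℕ) : Normal K (levelField γ n) := by
  have : (rightIterate γ n).IsSplittingField K (levelField γ n) :=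
    IntermediateField.adjoin_rootSet_isSplittingField
      (IsAlgClosed.splits ((rightIterate γ n).map (algebraMap K (AlgebraicClosure K))))
  exact Normal.of_isSplittingField (rightIterate γ n)

/-- The Galois group of the `n`-th splitting field over `K`. -/
abbrev LevelGroup (γ : ℕ → K[X]) (n : ℕ) : Type _ := levelField γ n ≃ₐ[K] levelField γ n

/-- Two automorphisms of intermediate fields agree on common elements. -/
def Compatible {E F : IntermediateField K (AlgebraicClosure K)}
    (σ : E ≃ₐ[K] E) (τ : F ≃ₐ[K] F) : Prop :=
  ∀ (x : E) (y : F), (x : AlgebraicClosure K) = y → (σ x : AlgebraicClosure K) = τ y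

theorem Compatible.symm {E F : IntermediateField K (AlgebraicClosure K)}
    {σ : E ≃ₐ[K] E} {τ : F ≃ₐ[K] F} (h : Compatible σ τ) : Compatible τ σ :=
  fun x y hxy => (h y x hxy.symm).symm

theorem Compatible.inv {E F : IntermediateField K (AlgebraicClosure K)} [Normal K E] [Normal K F]
    {σ : E ≃ₐ[K] E} {τ : F ≃ₐ[K] F} (h : Compatible σ τ) : Compatible σ⁻¹ τ⁻¹ := by
  intro x y hxy
  have hmem : ((σ⁻¹ x : E) : AlgebraicClosure K) ∈ F := by
    have h1 : (σ⁻¹).liftNormal (AlgebraicClosure K) (algebraMap E (AlgebraicClosure K) x)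
        = algebraMap E (AlgebraicClosure K) (σ⁻¹ x) := AlgEquiv.liftNormal_commutes _ _ _
    have h2 := (IntermediateField.normal_iff_forall_map_le'.1 (inferInstance : Normal K F))
      ((σ⁻¹).liftNormal (AlgebraicClosure K))
    apply h2
    exact ⟨y, y.2, by rw [← hxy]; exact h1⟩
  have h3 := h (σ⁻¹ x) ⟨_, hmem⟩ rfl
  have h4 : σ (σ⁻¹ x) = x := σ.apply_symm_apply x
  rw [h4, hxy] at h3
  have h5 : τ ⟨_, hmem⟩ = y := (Subtype.ext h3).symm
  have h6 : τ⁻¹ y = ⟨_, hmem⟩ := by rw [← h5]; exact τ.symm_apply_apply _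
  rw [h6]

/-- The inverse limit of the Galois groups of the splitting fields of the right iterates, with
respect to restriction: sequences of automorphisms, each restricting to the previous ones. -/
def galoisGroup (γ : ℕ → K[X]) : Subgroup (∀ n, LevelGroup γ n) where
  carrier := {σ | ∀ m n, m ≤ n → Compatible (σ m) (σ n)}
  mul_mem' {_ τ} hσ hτ m n hmn x y hxy :=
    hσ m n hmn (τ m x) (τ n y) (hτ m n hmn x y hxy)
  one_mem' _ _ _ _ _ hxy := hxy
  inv_mem' hσ m n hmn := (hσ m n hmn).inv

theorem galoisGroup_compatible {γ : ℕ → K[X]} (σ : galoisGroup γ) (m n : ℕ) :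
    Compatible (σ.1 m) (σ.1 n) := by
  rcases le_total m n with h | h
  · exact σ.2 m n h
  · exact (σ.2 n m h).symm

/-- The vertices of the preimage tree: all roots, in the algebraic closure of `K`, of right
iterates; the `0`-th iterate contributes the base point `0`, the root of the tree. -/
abbrev Vertex (γ : ℕ → K[X]) : Type _ :=
  {α : AlgebraicClosure K // ∃ m, α ∈ (rightIterate γ m).rootSet (AlgebraicClosure K)}

/-- The preimage tree: a root `α` of the iterate `θ₁ ∘ ⋯ ∘ θ_{m+1}` is joined to `θ_{m+1}(α)`. -/
def preimageTree (γ : ℕ → K[X]) : SimpleGraph (Vertex γ) :=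
  SimpleGraph.fromRel fun α β =>
    ∃ m, α.1 ∈ (rightIterate γ (m + 1)).rootSet (AlgebraicClosure K) ∧ aeval α.1 (γ m) = β.1

/-- The group of automorphisms of the preimage tree. -/
abbrev TreeAut (γ : ℕ → K[X]) : Type _ := preimageTree γ ≃g preimageTree γ

theorem mem_levelField {γ : ℕ → K[X]} {m : ℕ} {α : AlgebraicClosure K}
    (h : α ∈ (rightIterate γ m).rootSet (AlgebraicClosure K)) : α ∈ levelField γ m :=
  IntermediateField.subset_adjoin _ _ h

theorem map_mem_rootSet {γ : ℕ → K[X]} {m n : ℕ} (σ : LevelGroup γ m) {α : levelField γ m}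
    (h : (α : AlgebraicClosure K) ∈ (rightIterate γ n).rootSet (AlgebraicClosure K)) :
    (σ α : AlgebraicClosure K) ∈ (rightIterate γ n).rootSet (AlgebraicClosure K) := by
  rw [mem_rootSet] at h ⊢
  refine ⟨h.1, ?_⟩
  have h1 : aeval α (rightIterate γ n) = 0 := by
    apply Subtype.ext
    simpa using h.2
  have h2 : aeval (σ α) (rightIterate γ n) = 0 := by
    have := aeval_algHom_apply (σ : levelField γ m →ₐ[K] levelField γ m) α (rightIterate γ n)
    simpa [h1] using this
  have h3 := congrArg (Subtype.val) h2
  simpa using h3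

/-- The action of the inverse limit on vertices: a root `α` of the `m`-th iterate is moved by the
component at level `m`. -/
def vertexMap {γ : ℕ → K[X]} (σ : galoisGroup γ) (α : Vertex γ) : Vertex γ :=
  ⟨σ.1 α.2.choose ⟨α.1, mem_levelField α.2.choose_spec⟩,
    α.2.choose, map_mem_rootSet _ α.2.choose_spec⟩

/-- Any level whose field contains the vertex may be used to compute the action. -/
theorem vertexMap_val {γ : ℕ → K[X]} (σ : galoisGroup γ) (α : Vertex γ) (n : ℕ)
    (h : α.1 ∈ levelField γ n) : (vertexMap σ α).1 = σ.1 n ⟨α.1, h⟩ :=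
  galoisGroup_compatible σ _ n _ _ rfl

theorem vertexMap_one {γ : ℕ → K[X]} (α : Vertex γ) : vertexMap (1 : galoisGroup γ) α = α := rfl

theorem vertexMap_mul {γ : ℕ → K[X]} (σ τ : galoisGroup γ) (α : Vertex γ) :
    vertexMap (σ * τ) α = vertexMap σ (vertexMap τ α) := by
  apply Subtype.ext
  obtain ⟨m, hm⟩ := α.2
  have h := mem_levelField hm
  have h1 := vertexMap_val τ α m h
  have h2 : (vertexMap τ α).1 ∈ levelField γ m := by rw [h1]; exact Subtype.property _
  rw [vertexMap_val _ α m h, vertexMap_val σ _ m h2]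
  have h3 : (⟨(vertexMap τ α).1, h2⟩ : levelField γ m) = τ.1 m ⟨α.1, h⟩ := Subtype.ext h1
  rw [h3]
  rfl

theorem vertexMap_rel {γ : ℕ → K[X]} (σ : galoisGroup γ) {α β : Vertex γ} {m : ℕ}
    (hα : α.1 ∈ (rightIterate γ (m + 1)).rootSet (AlgebraicClosure K))
    (hβ : aeval α.1 (γ m) = β.1) :
    (vertexMap σ α).1 ∈ (rightIterate γ (m + 1)).rootSet (AlgebraicClosure K) ∧
      aeval (vertexMap σ α).1 (γ m) = (vertexMap σ β).1 := by
  have h := mem_levelField hα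
  have hv : (aeval (⟨α.1, h⟩ : levelField γ (m + 1)) (γ m) : levelField γ (m + 1)).1 = β.1 := by
    rw [← hβ]
    exact (aeval_algHom_apply (levelField γ (m + 1)).val ⟨α.1, h⟩ (γ m)).symm
  have hb : β.1 ∈ levelField γ (m + 1) := by rw [← hv]; exact Subtype.property _
  rw [vertexMap_val σ α _ h, vertexMap_val σ β _ hb]
  refine ⟨map_mem_rootSet (σ.1 (m + 1)) hα, ?_⟩
  have h1 : (⟨β.1, hb⟩ : levelField γ (m + 1)) = aeval (⟨α.1, h⟩ : levelField γ (m + 1)) (γ m) :=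
    Subtype.ext hv.symm
  have h2 := aeval_algHom_apply
    (σ.1 (m + 1) : levelField γ (m + 1) →ₐ[K] levelField γ (m + 1)) ⟨α.1, h⟩ (γ m)
  rw [h1]
  have h3 := congrArg Subtype.val h2
  simpa using h3

theorem vertexMap_injective {γ : ℕ → K[X]} (σ : galoisGroup γ) :
    Function.Injective (vertexMap σ) := fun α β h => by
  have := congrArg (vertexMap σ⁻¹) h
  rwa [← vertexMap_mul, ← vertexMap_mul, inv_mul_cancel, vertexMap_one, vertexMap_one] at this

theorem vertexMap_adj {γ : ℕ → K[X]} (σ : galoisGroup γ) {α β : Vertex γ}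
    (h : (preimageTree γ).Adj α β) : (preimageTree γ).Adj (vertexMap σ α) (vertexMap σ β) := by
  rw [preimageTree, SimpleGraph.fromRel_adj] at h ⊢
  refine ⟨fun he => h.1 (vertexMap_injective σ he), ?_⟩
  rcases h.2 with ⟨m, h1, h2⟩ | ⟨m, h1, h2⟩
  · exact Or.inl ⟨m, vertexMap_rel σ h1 h2⟩
  · exact Or.inr ⟨m, vertexMap_rel σ h1 h2⟩

theorem vertexMap_inv_left {γ : ℕ → K[X]} (σ : galoisGroup γ) (α : Vertex γ) :
    vertexMap σ⁻¹ (vertexMap σ α) = α := by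
  rw [← vertexMap_mul, inv_mul_cancel, vertexMap_one]

theorem vertexMap_inv_right {γ : ℕ → K[X]} (σ : galoisGroup γ) (α : Vertex γ) :
    vertexMap σ (vertexMap σ⁻¹ α) = α := by
  rw [← vertexMap_mul, mul_inv_cancel, vertexMap_one]

/-- The arboreal representation of a sequence of polynomials. -/
def arborealRep (γ : ℕ → K[X]) : galoisGroup γ →* TreeAut γ where
  toFun σ :=
    { toFun := vertexMap σ
      invFun := vertexMap σ⁻¹
      left_inv := vertexMap_inv_left σ
      right_inv := vertexMap_inv_right σ
      map_rel_iff' := fun {α β} => ⟨fun h => by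
        have := vertexMap_adj σ⁻¹ h
        simpa only [Equiv.coe_fn_mk, vertexMap_inv_left] using this, vertexMap_adj σ⟩ }
  map_one' := RelIso.ext fun α => vertexMap_one α
  map_mul' σ τ := RelIso.ext fun α => vertexMap_mul σ τ α

end Arboreal

end

/-! Write f_n = θ₁ ∘ ⋯ ∘ θ_n and θ_{n+1} = x² + c_n. Passing from the roots of f_n to those of
f_{n+1} adjoins the square roots of α − c_n, for α a root of f_n. The image is all of Aut(T_γ) as
soon as, at every level, the automorphisms fixing the roots of f_n realize every choice of signs on
these square roots. The realized sign vectors form a subspace V of the permutation module over F₂ on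
the roots of f_n, stable under Galois, which acts through a transitive 2-group. A nonzero module
over a 2-group in characteristic 2 has a nonzero fixed vector. Applied to the orthogonal complement
of V, this shows that V is everything once it contains one vector of nonzero coordinate sum
(`IsPGroup.eq_top_of_sum_ne_zero`), that is, once some automorphism moves the product of the square
roots. The square of that product is b_n = ± f_n(c_n). If it were fixed, the Kummer-type descent
`exists_prod_eq_sq_of_fixed` would make b_n times a product of some earlier b_i a square in K. It
therefore suffices that no nonempty product of the f_i(c_i) is, up to sign, a square in ℚ(t). Modulo
2 each f_i(c_i) has derivative 1, and their degrees 2^i d are distinct, so such a product has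
nonzero derivative modulo 2, which is impossible for a square. -/

noncomputable section

/-! ### Permutation modules of 2-groups over F₂ -/

/-- A submodule of the permutation module over `ZMod 2` of a transitive permutation `2`-group is
everything as soon as it contains a vector whose coordinates have nonzero sum. -/
theorem IsPGroup.eq_top_of_sum_ne_zero {X : Type*} [Fintype X] (H : Subgroup (Equiv.Perm X))
    (hH : IsPGroup 2 H) (htrans : ∀ x y, ∃ h ∈ H, h x = y)
    (V : Submodule (ZMod 2) (X → ZMod 2)) (hV : ∀ h ∈ H, ∀ v ∈ V, v ∘ h ∈ V)
    {v : X → ZMod 2} (hv : v ∈ V) (hsum : ∑ x, v x ≠ 0) : V = ⊤ := by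
  classical
  by_contra hne
  -- `W` is the orthogonal complement of `V` for the dot product. It is nonzero because a nonzero
  -- functional vanishing on `V` is the dot product with some vector.
  let W : Submodule (ZMod 2) (X → ZMod 2) :=
    { carrier := {w | ∀ u ∈ V, ∑ x, w x * u x = 0}
      add_mem' := fun {a b} ha hb u hu => by
        simp only [Pi.add_apply, add_mul, Finset.sum_add_distrib, ha u hu, hb u hu, add_zero]
      zero_mem' := fun u _ => by simp
      smul_mem' := fun r a ha u hu => by
        simp only [Pi.smul_apply, smul_eq_mul, mul_assoc, ← Finset.mul_sum, ha u hu, mul_zero] }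
  obtain ⟨f, hf, hVf⟩ := Submodule.exists_le_ker_of_lt_top V (lt_top_iff_ne_top.2 hne)
  have hfw : ∀ u : X → ZMod 2, f u = ∑ x, f (Pi.single x 1) * u x := by
    intro u
    conv_lhs => rw [← LinearMap.sum_single_apply (fun _ => ZMod 2) u, map_sum]
    refine Finset.sum_congr rfl fun x _ => ?_
    have : (Pi.single x (u x) : X → ZMod 2) = u x • (Pi.single x 1 : X → ZMod 2) := by
      ext y
      simp [Pi.single_apply]
    rw [this, map_smul, smul_eq_mul, mul_comm]
  let w₀ : W := ⟨fun x => f (Pi.single x 1), fun u hu => by rw [← hfw]; exact hVf hu⟩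
  have hw₀ : w₀ ≠ 0 := by
    intro h
    apply hf
    ext1 x
    ext
    have := congrFun (congrArg Subtype.val h) x
    simpa [w₀] using this
  have : Nontrivial W := ⟨⟨w₀, 0, hw₀⟩⟩
  let _ : MulAction H W :=
    { smul := fun h w => ⟨fun x => w.1 (h.1⁻¹ x), fun u hu => by
        have := w.2 _ (hV h.1 h.2 u hu)
        rw [← Equiv.sum_comp h.1]
        simpa using this⟩
      one_smul := fun w => rfl
      mul_smul := fun a b w => by
        apply Subtype.ext
        funext x
        change w.1 ((a.1 * b.1)⁻¹ x) = w.1 (b.1⁻¹ (a.1⁻¹ x))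
        rw [mul_inv_rev]
        rfl }
  -- The fixed points of a 2-group on a set of even size are even in number, so `0` is not the only
  -- one. By transitivity the other one is a nonzero constant vector, and its orthogonality to `v`
  -- contradicts `hsum`.
  have hcard : 2 ∣ Nat.card W := by
    rw [Module.natCard_eq_pow_finrank (K := ZMod 2), Nat.card_zmod]
    exact dvd_pow_self 2 Module.finrank_pos.ne'
  obtain ⟨b, hb, hb0⟩ := hH.exists_fixed_point_of_prime_dvd_card_of_fixed_point W hcard
    (a := 0) (fun h => rfl)
  have hconst : ∀ x y, b.1 x = b.1 y := by
    intro x y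
    obtain ⟨h, hh, rfl⟩ := htrans x y
    have := congrFun (congrArg Subtype.val (hb ⟨h, hh⟩)) (h x)
    change b.1 (h⁻¹ (h x)) = _ at this
    simpa using this
  apply hsum
  have h1 := b.2 v hv
  by_cases hX : IsEmpty X
  · simp
  obtain ⟨x₀⟩ := not_isEmpty_iff.1 hX
  simp_rw [hconst _ x₀, ← Finset.mul_sum] at h1
  refine (mul_eq_zero.1 h1).resolve_left fun h0 => hb0 ?_
  apply Subtype.ext
  funext x
  rw [hconst x x₀, h0]
  rfl

/-! ### Non-squares in ℚ(t) detected by the derivative modulo 2 -/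

namespace Polynomial

/-- A finite product of polynomials with derivative `1` and pairwise distinct degrees has nonzero
derivative. -/
theorem derivative_prod_ne_zero_of_derivative_eq_one {F ι : Type*} [Field F]
    (b : ι → F[X]) (hb : ∀ i, derivative (b i) = 1)
    (hdeg : Function.Injective fun i => (b i).natDegree) {I : Finset ι} (hI : I.Nonempty) :
    derivative (∏ i ∈ I, b i) ≠ 0 := by
  classical
  have hb0 : ∀ i, b i ≠ 0 := fun i h => by simpa [h] using hb i
  have hP : ∀ i, ∏ j ∈ I.erase i, b j ≠ 0 := fun i => Finset.prod_ne_zero_iff.2 fun j _ => hb0 j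
  rw [derivative_prod_finset]
  simp only [hb, mul_one]
  intro h0
  -- The summand omitting `b i` has the degree of the full product minus that of `b i`. These
  -- degrees are distinct, so nothing cancels.
  have h := degree_sum_eq_of_disjoint (fun i => ∏ j ∈ I.erase i, b j) I ?_
  · rw [h0, degree_zero, eq_comm, Finset.sup_eq_bot_iff] at h
    obtain ⟨i, hi⟩ := hI
    exact hP i (degree_eq_bot.1 (h i hi))
  · rintro i ⟨hi, -⟩ j ⟨hj, -⟩ hij h
    apply hij
    apply hdeg
    have h1 := Finset.mul_prod_erase I b hi
    have h2 := Finset.mul_prod_erase I b hj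
    have h3 : (∏ j ∈ I.erase i, b j).natDegree = (∏ k ∈ I.erase j, b k).natDegree :=
      natDegree_eq_of_degree_eq h
    have h4 := congrArg natDegree (h1.trans h2.symm)
    rw [natDegree_mul (hb0 i) (hP i), natDegree_mul (hb0 j) (hP j), h3] at h4
    exact Nat.add_right_cancel h4

/-- If the reduction of `P` modulo `2` has nonzero derivative, then `P` is not the square of a
fraction. -/
theorem sq_ne_mul_sq_of_derivative_map_ne_zero {P : ℤ[X]}
    (hP : derivative (P.map (Int.castRingHom (ZMod 2))) ≠ 0) (u : ℤ[X]) {v : ℤ[X]} (hv : v ≠ 0) :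
    u ^ 2 ≠ P * v ^ 2 := by
  intro h
  have hirr : Irreducible (C 2 : ℤ[X]) := (prime_C_iff.2 Int.prime_two).irreducible
  -- Removing the exact power of 2 from `v`, and hence from `u`, leaves `w` nonzero modulo 2.
  -- Squares have derivative zero there, so differentiating leaves `P' * w ^ 2 = 0`.
  obtain ⟨k, w, hw, rfl⟩ := WfDvdMonoid.max_power_factor hv hirr
  have hdvd : (C 2 : ℤ[X]) ^ k ∣ u := by
    rw [← IsIntegrallyClosed.pow_dvd_pow_iff two_ne_zero, h]
    exact ⟨P * w ^ 2, by ring⟩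
  obtain ⟨u, rfl⟩ := hdvd
  have hk : ((C 2 : ℤ[X]) ^ k) ^ 2 ≠ 0 := pow_ne_zero _ (pow_ne_zero _ hirr.ne_zero)
  have h' : u ^ 2 = P * w ^ 2 := mul_left_cancel₀ hk (by linear_combination h)
  have hw' : w.map (Int.castRingHom (ZMod 2)) ≠ 0 := by
    intro h0
    apply hw
    rw [C_dvd_iff_dvd_coeff]
    intro i
    have := congrArg (fun p => coeff p i) h0
    simpa [ZMod.intCast_zmod_eq_zero_iff_dvd] using (this : _ = _)
  have h2 := congrArg (fun p => derivative (p.map (Int.castRingHom (ZMod 2)))) h'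
  have h20 : (C 2 : (ZMod 2)[X]) = 0 := by rw [show (2 : ZMod 2) = 0 from rfl, C_0]
  simp only [Polynomial.map_mul, Polynomial.map_pow, derivative_mul, derivative_sq, h20, zero_mul,
    mul_zero, add_zero] at h2
  exact mul_ne_zero hP (pow_ne_zero 2 hw') h2.symm

theorem exists_map_eq_intCast_mul (u : ℚ[X]) :
    ∃ (N : ℤ) (U : ℤ[X]), N ≠ 0 ∧ U.map (Int.castRingHom ℚ) = C (N : ℚ) * u := by
  obtain ⟨N, hN, h⟩ := IsLocalization.integerNormalization_spec (nonZeroDivisors ℤ) u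
  refine ⟨N, IsLocalization.integerNormalization (nonZeroDivisors ℤ) u,
    nonZeroDivisors.ne_zero hN, ?_⟩
  rw [← algebraMap_int_eq, h, ← Int.cast_smul_eq_zsmul ℚ, smul_eq_C_mul]

theorem algebraMap_map_ne_sq_of_derivative_map_ne_zero {P : ℤ[X]}
    (hP : derivative (P.map (Int.castRingHom (ZMod 2))) ≠ 0) (s : RatFunc ℚ) :
    algebraMap ℚ[X] (RatFunc ℚ) (P.map (Int.castRingHom ℚ)) ≠ s ^ 2 := by
  intro h
  obtain ⟨N, U, hN, hU⟩ := exists_map_eq_intCast_mul s.num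
  obtain ⟨M, V, hM, hV⟩ := exists_map_eq_intCast_mul s.denom
  have hd : s.denom ≠ 0 := s.denom_ne_zero
  have hd' : algebraMap ℚ[X] (RatFunc ℚ) s.denom ≠ 0 := by
    simpa using hd
  have h1 : s.num ^ 2 = P.map (Int.castRingHom ℚ) * s.denom ^ 2 := by
    apply IsFractionRing.injective ℚ[X] (RatFunc ℚ)
    rw [map_mul, map_pow, map_pow, h, ← mul_pow]
    congr 1
    conv_rhs => rw [← RatFunc.num_div_denom s, div_mul_eq_mul_div]
    rw [RatFunc.num_div_denom, mul_div_cancel_right₀ _ hd']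
  have hinj : Function.Injective (Polynomial.map (Int.castRingHom ℚ)) :=
    map_injective _ (Int.castRingHom ℚ).injective_int
  have hV0 : V ≠ 0 := by
    rintro rfl
    rw [Polynomial.map_zero, eq_comm, mul_eq_zero, C_eq_zero] at hV
    exact hV.elim (by exact_mod_cast hM) hd
  -- `U` is `N` times the numerator and `V` is `M` times the denominator; cross-multiplying scales
  -- both by `M * N`.
  refine sq_ne_mul_sq_of_derivative_map_ne_zero hP (C M * U) (v := C N * V)
    (mul_ne_zero (C_ne_zero.2 hN) hV0) (hinj ?_)
  simp only [Polynomial.map_mul, Polynomial.map_pow, hU, hV, map_C, eq_intCast (Int.castRingHom ℚ)]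
  linear_combination (C (M : ℚ) * C (N : ℚ)) ^ 2 * h1

end Polynomial
end

/-! ### Roots of the iterates, level stabilizers and sign changes -/

noncomputable section

namespace Arboreal

section Quadratic

variable {K E : Type*} [Field K] [Field E] [Algebra K E]

variable (E) in
/-- The sign `±1` attached to an element of `ZMod 2`. -/
def zmodSign (a : ZMod 2) : E := if a = 0 then 1 else -1

theorem zmodSign_add (a b : ZMod 2) : zmodSign E (a + b) = zmodSign E a * zmodSign E b := by
  have h : ∀ a : ZMod 2, a = 0 ∨ a = 1 := by decide
  rcases h a with rfl | rfl <;> rcases h b with rfl | rfl <;>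
    simp [zmodSign, show (1 : ZMod 2) + 1 = 0 from rfl]

theorem zmodSign_sum {ι : Type*} (s : Finset ι) (v : ι → ZMod 2) :
    zmodSign E (∑ x ∈ s, v x) = ∏ x ∈ s, zmodSign E (v x) := by
  classical
  induction s using Finset.induction_on with
  | empty => simp [zmodSign]
  | insert a s ha ih => rw [Finset.sum_insert ha, Finset.prod_insert ha, zmodSign_add, ih]

theorem map_zmodSign (σ : E ≃ₐ[K] E) (a : ZMod 2) : σ (zmodSign E a) = zmodSign E a := by
  unfold zmodSign
  split_ifs <;> simp

/-- The stabilizer of an element whose square lies in the base field is normal. -/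
theorem normal_stabilizer_of_sq {r : E} {β : K} (hr : r ^ 2 = algebraMap K E β) :
    (MulAction.stabilizer (E ≃ₐ[K] E) r).Normal where
  conj_mem σ hσ g := by
    change g (σ (g.symm r)) = r
    have hσ : σ r = r := hσ
    have h : g.symm r = r ∨ g.symm r = -r := by
      rw [← sq_eq_sq_iff_eq_or_eq_neg, ← map_pow, hr, g.symm.commutes]
    have h2 : σ (g.symm r) = g.symm r := by rcases h with h | h <;> simp [h, hσ]
    rw [h2, g.apply_symm_apply]

variable [IsAlgClosed E]

/-- A chosen square root in an algebraically closed field. -/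
def sqrtOf (a : E) : E := (IsAlgClosed.exists_pow_nat_eq a two_pos).choose

theorem sqrtOf_sq (a : E) : sqrtOf a ^ 2 = a :=
  (IsAlgClosed.exists_pow_nat_eq a two_pos).choose_spec

variable (E) in
open Classical in
/-- The roots of the `n`-th right iterate of the sequence `X ^ 2 + c n`. -/
def levelRoots (c : ℕ → K) : ℕ → Finset E
  | 0 => {0}
  | n + 1 => (levelRoots c n).biUnion fun α =>
      {sqrtOf (α - algebraMap K E (c n)), -sqrtOf (α - algebraMap K E (c n))}

theorem mem_levelRoots_zero {c : ℕ → K} {α : E} : α ∈ levelRoots E c 0 ↔ α = 0 := by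
  simp [levelRoots]

theorem mem_levelRoots_succ {c : ℕ → K} {n : ℕ} {β : E} :
    β ∈ levelRoots E c (n + 1) ↔ β ^ 2 + algebraMap K E (c n) ∈ levelRoots E c n := by
  classical
  simp only [levelRoots, Finset.mem_biUnion, Finset.mem_insert, Finset.mem_singleton]
  simp_rw [← sq_eq_sq_iff_eq_or_eq_neg, sqrtOf_sq, eq_sub_iff_add_eq]
  simp

theorem mem_levelRoots_iff {c : ℕ → K} {n : ℕ} {α : E} :
    α ∈ levelRoots E c n ↔ aeval α (rightIterate (fun n => X ^ 2 + C (c n)) n) = 0 := by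
  induction n generalizing α with
  | zero => simp [mem_levelRoots_zero, rightIterate]
  | succ n ih =>
    rw [mem_levelRoots_succ, ih]
    simp [rightIterate, aeval_comp]

theorem neg_mem_levelRoots_succ {c : ℕ → K} {n : ℕ} {β : E} (h : β ∈ levelRoots E c (n + 1)) :
    -β ∈ levelRoots E c (n + 1) := by
  rw [mem_levelRoots_succ] at h ⊢
  rwa [neg_sq]

theorem map_mem_levelRoots {c : ℕ → K} (σ : E ≃ₐ[K] E) {n : ℕ} {α : E}
    (h : α ∈ levelRoots E c n) : σ α ∈ levelRoots E c n := by
  induction n generalizing α with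
  | zero => simp_all [mem_levelRoots_zero]
  | succ n ih =>
    rw [mem_levelRoots_succ] at h ⊢
    simpa using ih h

variable (E) in
/-- The product of the chosen square roots adjoined when passing from level `n` to the next. -/
def levelProd (c : ℕ → K) (n : ℕ) : E :=
  ∏ α ∈ levelRoots E c n, sqrtOf (α - algebraMap K E (c n))

theorem sqrtOf_mem_levelRoots {c : ℕ → K} {n : ℕ} {α : E} (h : α ∈ levelRoots E c n) :
    sqrtOf (α - algebraMap K E (c n)) ∈ levelRoots E c (n + 1) := by
  rw [mem_levelRoots_succ, sqrtOf_sq, sub_add_cancel]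
  exact h

theorem eq_or_eq_neg_sqrtOf {c : ℕ → K} {n : ℕ} (β : E) :
    β = sqrtOf ((β ^ 2 + algebraMap K E (c n)) - algebraMap K E (c n)) ∨
      β = -sqrtOf ((β ^ 2 + algebraMap K E (c n)) - algebraMap K E (c n)) := by
  rw [← sq_eq_sq_iff_eq_or_eq_neg, sqrtOf_sq, add_sub_cancel_right]

theorem map_sqrtOf_eq_or {c : ℕ → K} {n : ℕ} (σ : E ≃ₐ[K] E) (α : E) :
    σ (sqrtOf (α - algebraMap K E (c n))) = sqrtOf (σ α - algebraMap K E (c n)) ∨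
      σ (sqrtOf (α - algebraMap K E (c n))) = -sqrtOf (σ α - algebraMap K E (c n)) := by
  rw [← sq_eq_sq_iff_eq_or_eq_neg, ← map_pow, sqrtOf_sq, sqrtOf_sq, map_sub, σ.commutes]

variable (E) in
/-- The automorphisms fixing all roots of the `n`-th right iterate. -/
def levelStab (c : ℕ → K) (n : ℕ) : Subgroup (E ≃ₐ[K] E) where
  carrier := {σ | ∀ α ∈ levelRoots E c n, σ α = α}
  mul_mem' {σ τ} hσ hτ α hα := by rw [AlgEquiv.mul_apply, hτ α hα, hσ α hα]
  one_mem' _ _ := rfl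
  inv_mem' {σ} hσ α hα := by
    change σ.symm α = α
    rw [AlgEquiv.symm_apply_eq, hσ α hα]

theorem mem_levelStab {c : ℕ → K} {n : ℕ} {σ : E ≃ₐ[K] E} :
    σ ∈ levelStab E c n ↔ ∀ α ∈ levelRoots E c n, σ α = α := Iff.rfl

instance levelStab_normal (c : ℕ → K) (n : ℕ) : (levelStab E c n).Normal where
  conj_mem σ hσ g α hα := by
    change g (σ (g⁻¹ α)) = α
    rw [hσ _ (map_mem_levelRoots _ hα)]
    exact g.apply_symm_apply α

theorem levelStab_succ_le (c : ℕ → K) (n : ℕ) : levelStab E c (n + 1) ≤ levelStab E c n := by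
  intro σ hσ α hα
  have h := congrArg (fun x => x ^ 2 + algebraMap K E (c n)) (hσ _ (sqrtOf_mem_levelRoots hα))
  simp only [← map_pow, sqrtOf_sq] at h
  simpa using h

theorem levelStab_antitone (c : ℕ → K) : Antitone (levelStab E c) :=
  antitone_nat_of_succ_le (levelStab_succ_le c)

theorem mem_levelStab_succ {c : ℕ → K} {n : ℕ} {σ : E ≃ₐ[K] E}
    (h : ∀ α ∈ levelRoots E c n,
      σ (sqrtOf (α - algebraMap K E (c n))) = sqrtOf (α - algebraMap K E (c n))) :
    σ ∈ levelStab E c (n + 1) := by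
  intro β hβ
  have hs := h _ (mem_levelRoots_succ.1 hβ)
  rcases eq_or_eq_neg_sqrtOf (c := c) (n := n) β with h1 | h1
  · rw [h1, hs]
  · rw [h1, map_neg, hs]

theorem map_sqrtOf_eq_or_of_mem {c : ℕ → K} {n : ℕ} {σ : E ≃ₐ[K] E} (hσ : σ ∈ levelStab E c n)
    {α : E} (hα : α ∈ levelRoots E c n) :
    σ (sqrtOf (α - algebraMap K E (c n))) = sqrtOf (α - algebraMap K E (c n)) ∨
      σ (sqrtOf (α - algebraMap K E (c n))) = -sqrtOf (α - algebraMap K E (c n)) := by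
  simpa [hσ α hα] using map_sqrtOf_eq_or (c := c) (n := n) σ α

theorem sq_mem_levelStab_succ {c : ℕ → K} {n : ℕ} {σ : E ≃ₐ[K] E} (hσ : σ ∈ levelStab E c n) :
    σ ^ 2 ∈ levelStab E c (n + 1) := by
  refine mem_levelStab_succ fun α hα => ?_
  rw [pow_two, AlgEquiv.mul_apply]
  rcases map_sqrtOf_eq_or_of_mem hσ hα with h | h <;> simp [h]

/-- An automorphism fixing level `n` changes only signs one level up, so its square fixes level `n +
1`. Hence Galois acts on each level through a 2-group. -/
theorem pow_mem_levelStab (c : ℕ → K) (σ : E ≃ₐ[K] E) (n : ℕ) :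
    σ ^ 2 ^ n ∈ levelStab E c n := by
  induction n with
  | zero =>
    intro α hα
    rw [mem_levelRoots_zero.1 hα, map_zero]
  | succ n ih =>
    rw [pow_succ, pow_mul]
    exact sq_mem_levelStab_succ ih

instance levelRootsMulAction (c : ℕ → K) (n : ℕ) :
    MulAction (E ≃ₐ[K] E) (levelRoots E c n) where
  smul σ α := ⟨σ α.1, map_mem_levelRoots σ α.2⟩
  one_smul _ := rfl
  mul_smul _ _ _ := rfl

theorem levelRoots_smul_val {c : ℕ → K} {n : ℕ} (σ : E ≃ₐ[K] E) (α : levelRoots E c n) :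
    (σ • α).1 = σ α.1 := rfl

/-- The sign changes of the chosen square roots that a subgroup of the stabilizer of level `n`
induces, as a subspace over `ZMod 2`. -/
def signSpace (c : ℕ → K) (n : ℕ) (N : Subgroup (E ≃ₐ[K] E)) :
    Submodule (ZMod 2) (levelRoots E c n → ZMod 2) where
  carrier := {v | ∃ σ ∈ N, ∀ x : levelRoots E c n,
    σ (sqrtOf (x.1 - algebraMap K E (c n))) =
      zmodSign E (v x) * sqrtOf (x.1 - algebraMap K E (c n))}
  add_mem' := by
    rintro a b ⟨σ, hσ, ha⟩ ⟨τ, hτ, hb⟩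
    refine ⟨σ * τ, N.mul_mem hσ hτ, fun x => ?_⟩
    rw [AlgEquiv.mul_apply, hb, map_mul, ha, map_zmodSign, Pi.add_apply, zmodSign_add]
    ring
  zero_mem' := ⟨1, N.one_mem, fun x => by simp [zmodSign]⟩
  smul_mem' := by
    rintro r v ⟨σ, hσ, hv⟩
    have h : ∀ a : ZMod 2, a = 0 ∨ a = 1 := by decide
    rcases h r with rfl | rfl
    · exact ⟨1, N.one_mem, fun x => by simp [zmodSign]⟩
    · exact ⟨σ, hσ, fun x => by simpa using hv x⟩

/-- A normal subgroup of the stabilizer of level `n` that moves the product of the chosen square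
roots realizes all sign changes of these square roots. -/
theorem exists_sign {c : ℕ → K} {n : ℕ} {N : Subgroup (E ≃ₐ[K] E)} (hnormal : N.Normal)
    (hN : N ≤ levelStab E c n)
    (htrans : ∀ α ∈ levelRoots E c n, ∀ β ∈ levelRoots E c n, ∃ g : E ≃ₐ[K] E, g α = β)
    (hp : ∃ σ ∈ N, σ (levelProd E c n) ≠ levelProd E c n)
    (ε : E → E) (hε : ∀ α, ε α = 1 ∨ ε α = -1) :
    ∃ σ ∈ N, ∀ α ∈ levelRoots E c n,
      σ (sqrtOf (α - algebraMap K E (c n))) = ε α * sqrtOf (α - algebraMap K E (c n)) := by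
  classical
  set π := MulAction.toPermHom (E ≃ₐ[K] E) (levelRoots E c n)
  have htop : signSpace c n N = ⊤ := by
    obtain ⟨σ, hσ, hσp⟩ := hp
    have hv : ∀ x : levelRoots E c n, ∃ a : ZMod 2,
        σ (sqrtOf (x.1 - algebraMap K E (c n))) =
          zmodSign E a * sqrtOf (x.1 - algebraMap K E (c n)) := by
      intro x
      rcases map_sqrtOf_eq_or_of_mem (hN hσ) x.2 with h | h
      · exact ⟨0, by simp [h, zmodSign]⟩
      · exact ⟨1, by simp [h, zmodSign]⟩
    choose v hv using hv
    refine IsPGroup.eq_top_of_sum_ne_zero π.range ?_ ?_ _ ?_ (v := v) ⟨σ, hσ, hv⟩ ?_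
    · rintro ⟨_, g, rfl⟩
      refine ⟨n, Subtype.ext ?_⟩
      change π g ^ 2 ^ n = 1
      rw [← map_pow]
      ext x
      exact pow_mem_levelStab c g n x.1 x.2
    · intro x y
      obtain ⟨g, hg⟩ := htrans x.1 x.2 y.1 y.2
      exact ⟨π g, ⟨g, rfl⟩, Subtype.ext hg⟩
    · rintro _ ⟨g, rfl⟩ w ⟨τ, hτ, hw⟩
      -- Conjugation by `g` permutes the coordinates of the sign vector: the sign with which `g`
      -- moves a chosen square root occurs twice and cancels. Normality keeps the conjugate in `N`.
      refine ⟨g⁻¹ * τ * g, by simpa using hnormal.conj_mem τ hτ g⁻¹, fun x => ?_⟩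
      have hx := hw (g • x)
      rw [levelRoots_smul_val] at hx
      have key : τ (g (sqrtOf (x.1 - algebraMap K E (c n)))) =
          zmodSign E (w (g • x)) * g (sqrtOf (x.1 - algebraMap K E (c n))) := by
        rcases map_sqrtOf_eq_or (c := c) (n := n) g x.1 with h | h
        · rw [h, hx]
        · rw [h, map_neg, hx, mul_neg]
      change g.symm (τ (g _)) = _
      rw [key, map_mul, map_zmodSign, g.symm_apply_apply]
      rfl
    -- `σ` multiplies the product of the square roots by the sign of the coordinate sum.
    · intro h0
      apply hσp
      rw [levelProd, ← Finset.prod_coe_sort, map_prod]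
      simp_rw [hv]
      rw [Finset.prod_mul_distrib, ← zmodSign_sum, h0]
      simp [zmodSign]
  obtain ⟨σ, hσ, h⟩ : (fun x => if ε x.1 = 1 then 0 else 1) ∈ signSpace c n N :=
    htop ▸ Submodule.mem_top
  refine ⟨σ, hσ, fun α hα => ?_⟩
  rw [h ⟨α, hα⟩]
  congr 1
  by_cases h1 : ε α = 1
  · simp [h1, zmodSign]
  · simp only [if_neg h1]
    exact (if_neg one_ne_zero).trans ((hε α).resolve_left h1).symm

/-- Otherwise `hdown`, applied to the product itself, makes `b n` times a product of `b i` with `i <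
n` a square, contrary to `hns`. -/
theorem exists_map_levelProd_ne {c : ℕ → K} {b : ℕ → K}
    (hb : ∀ n, levelProd E c n ^ 2 = algebraMap K E (b n))
    (hns : ∀ I : Finset ℕ, I.Nonempty → ∀ s : K, ∏ i ∈ I, b i ≠ s ^ 2) {n : ℕ}
    (hdown : ∀ (r : E) (β : K), r ^ 2 = algebraMap K E β → (∀ σ ∈ levelStab E c n, σ r = r) →
      ∃ I ⊆ Finset.range n, ∃ s : K, β * ∏ i ∈ I, b i = s ^ 2) :
    ∃ σ ∈ levelStab E c n, σ (levelProd E c n) ≠ levelProd E c n := by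
  by_contra! h
  obtain ⟨I, hI, s, hs⟩ := hdown _ _ (hb n) h
  have hn : n ∉ I := fun hn => by simpa using hI hn
  exact hns (insert n I) (Finset.insert_nonempty n I) s (by rw [Finset.prod_insert hn, hs])

/-- The square roots of elements of the base field that are fixed by the stabilizer of a level are
accounted for by the elements `b i` of lower levels. -/
theorem exists_prod_eq_sq_of_fixed [CharZero E] {c : ℕ → K} {b : ℕ → K} [IsGalois K E]
    (hb : ∀ n, levelProd E c n ^ 2 = algebraMap K E (b n))
    (hns : ∀ I : Finset ℕ, I.Nonempty → ∀ s : K, ∏ i ∈ I, b i ≠ s ^ 2) (n : ℕ)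
    (htrans : ∀ m < n, ∀ α ∈ levelRoots E c m, ∀ β ∈ levelRoots E c m,
      ∃ g : E ≃ₐ[K] E, g α = β) (r : E) (β : K) (hr : r ^ 2 = algebraMap K E β)
    (hfix : ∀ σ ∈ levelStab E c n, σ r = r) :
    ∃ I ⊆ Finset.range n, ∃ s : K, β * ∏ i ∈ I, b i = s ^ 2 := by
  induction n generalizing r β with
  | zero =>
    -- Level 0 consists of `0` alone, so its stabilizer is the whole Galois group and `r` lies in
    -- the base field.
    obtain ⟨s, rfl⟩ := IntermediateField.mem_bot.1 ((InfiniteGalois.mem_bot_iff_fixed r).2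
      fun σ => hfix σ fun α hα => by rw [mem_levelRoots_zero.1 hα, map_zero])
    refine ⟨∅, Finset.empty_subset _, s, ?_⟩
    rw [Finset.prod_empty, mul_one]
    exact (algebraMap K E).injective (by rw [← hr, map_pow])
  | succ n ih =>
    specialize ih fun m hm => htrans m (by lia)
    by_cases hn : ∀ σ ∈ levelStab E c n, σ r = r
    · obtain ⟨I, hI, h⟩ := ih r β hr hn
      exact ⟨I, hI.trans (Finset.range_subset_range.2 n.le_succ), h⟩
    have hsign : ∀ (σ : E ≃ₐ[K] E) {x : E} {a : K}, x ^ 2 = algebraMap K E a →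
        σ x = x ∨ σ x = -x := fun σ x a hx => by
      rw [← sq_eq_sq_iff_eq_or_eq_neg, ← map_pow, hx, σ.commutes]
    obtain ⟨τ, hτ, hτp⟩ := exists_map_levelProd_ne hb hns ih
    have hτp' := (hsign τ (hb n)).resolve_left hτp
    -- If some `σ` fixed `r` but moved the product, `exists_sign` would apply to the normal subgroup
    -- fixing both level `n` and `r`. Every `g` fixing level `n` would then agree on level `n + 1`
    -- with some `ρ` in that subgroup, so `g` would fix `r` as well, contrary to `hn`.
    have hNp : ∀ σ ∈ levelStab E c n, σ r = r → σ (levelProd E c n) = levelProd E c n := by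
      by_contra! h
      obtain ⟨σ, hσ, hσr, hσp⟩ := h
      have hnormal := normal_stabilizer_of_sq hr
      apply hn
      intro g hg
      have hε : ∀ α, ∃ e : E, (e = 1 ∨ e = -1) ∧ (α ∈ levelRoots E c n →
          g (sqrtOf (α - algebraMap K E (c n))) = e * sqrtOf (α - algebraMap K E (c n))) := by
        intro α
        by_cases hα : α ∈ levelRoots E c n
        · rcases map_sqrtOf_eq_or_of_mem hg hα with h | h
          · exact ⟨1, Or.inl rfl, fun _ => by simp [h]⟩
          · exact ⟨-1, Or.inr rfl, fun _ => by simp [h]⟩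
        · exact ⟨1, Or.inl rfl, fun h => absurd h hα⟩
      choose ε hε1 hε2 using hε
      obtain ⟨ρ, hρ, h⟩ := exists_sign
        (N := levelStab E c n ⊓ MulAction.stabilizer (E ≃ₐ[K] E) r) inferInstance inf_le_left
        (htrans n n.lt_succ_self) ⟨σ, ⟨hσ, hσr⟩, hσp⟩ ε hε1
      have h1 : g⁻¹ * ρ ∈ levelStab E c (n + 1) := by
        refine mem_levelStab_succ fun α hα => ?_
        change g.symm (ρ _) = _
        rw [h α hα, ← hε2 α hα, g.symm_apply_apply]
      have h2 : g.symm (ρ r) = r := hfix _ h1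
      have h3 : ρ r = r := hρ.2
      rw [h3, AlgEquiv.symm_apply_eq] at h2
      exact h2.symm
    have hp0 : levelProd E c n ≠ 0 := fun h => hτp (by rw [h, map_zero])
    -- On the stabilizer of level `n`, `r` and the product now change sign together, so `r *
    -- levelProd E c n` is fixed and the induction applies to it. In the one remaining case, where
    -- `σ` moves only the product, `σ * τ` would fix `r` and still move the product.
    obtain ⟨I, hI, s, hs⟩ := ih (r * levelProd E c n) (β * b n)
      (by rw [mul_pow, hr, hb, map_mul]) (by
        intro σ hσ
        rw [map_mul]
        rcases hsign σ hr with h | h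
        · rw [h, hNp σ hσ h]
        · rcases hsign σ (hb n) with h1 | h1
          · have hτr := (hsign τ hr).resolve_left fun h' => hτp (hNp τ hτ h')
            have h2 := hNp (σ * τ) (mul_mem hσ hτ) (by
              rw [AlgEquiv.mul_apply, hτr, map_neg, h, neg_neg])
            rw [AlgEquiv.mul_apply, hτp', map_neg, h1] at h2
            exact absurd h2 (by simpa [neg_eq_iff_add_eq_zero, self_eq_neg] using hp0)
          · rw [h, h1, neg_mul_neg])
    have hnI : n ∉ I := fun h => by simpa using hI h
    refine ⟨insert n I, ?_, s, ?_⟩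
    · rw [Finset.range_add_one]
      exact Finset.insert_subset_insert n hI
    · rw [Finset.prod_insert hnI, ← mul_assoc, hs]

/-- An automorphism matching the parents matches the two roots up to sign, and one that flips every
new square root repairs the sign. The induction is strong because the descent needs transitivity on
all lower levels. -/
theorem transitive_levelRoots [CharZero E] {c : ℕ → K} {b : ℕ → K} [IsGalois K E]
    (hb : ∀ n, levelProd E c n ^ 2 = algebraMap K E (b n))
    (hns : ∀ I : Finset ℕ, I.Nonempty → ∀ s : K, ∏ i ∈ I, b i ≠ s ^ 2) (n : ℕ) :
    ∀ α ∈ levelRoots E c n, ∀ β ∈ levelRoots E c n, ∃ g : E ≃ₐ[K] E, g α = β := by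
  induction n using Nat.strong_induction_on with
  | _ n ih =>
    rcases n with _ | n
    · intro α hα β hβ
      rw [mem_levelRoots_zero] at hα hβ
      exact ⟨1, by simp [hα, hβ]⟩
    intro β hβ β' hβ'
    have htrans := ih n n.lt_succ_self
    obtain ⟨g, hg⟩ := htrans _ (mem_levelRoots_succ.1 hβ) _ (mem_levelRoots_succ.1 hβ')
    have h : g β = β' ∨ g β = -β' := by
      rw [← sq_eq_sq_iff_eq_or_eq_neg]
      simpa using hg
    rcases h with h | h
    · exact ⟨g, h⟩
    obtain ⟨τ, -, hτ⟩ := exists_sign (levelStab_normal c n) le_rfl htrans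
      (exists_map_levelProd_ne hb hns (exists_prod_eq_sq_of_fixed hb hns n
        fun m hm => ih m (by lia))) (fun _ => -1) (fun _ => Or.inr rfl)
    have hs := hτ _ (mem_levelRoots_succ.1 hβ)
    have hτβ : τ β = -β := by
      rcases eq_or_eq_neg_sqrtOf (c := c) (n := n) β with h1 | h1
      · rw [h1, hs, neg_one_mul]
      · rw [h1, map_neg, hs, neg_one_mul]
    exact ⟨g * τ, by rw [AlgEquiv.mul_apply, hτβ, map_neg, h, neg_neg]⟩

/-- All sign changes of the square roots adjoined at a given level are realized by automorphisms
that fix the level pointwise. -/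
theorem exists_sign_levelStab [CharZero E] {c : ℕ → K} {b : ℕ → K} [IsGalois K E]
    (hb : ∀ n, levelProd E c n ^ 2 = algebraMap K E (b n))
    (hns : ∀ I : Finset ℕ, I.Nonempty → ∀ s : K, ∏ i ∈ I, b i ≠ s ^ 2) (n : ℕ)
    (ε : E → E) (hε : ∀ α, ε α = 1 ∨ ε α = -1) :
    ∃ σ ∈ levelStab E c n, ∀ α ∈ levelRoots E c n,
      σ (sqrtOf (α - algebraMap K E (c n))) = ε α * sqrtOf (α - algebraMap K E (c n)) :=
  exists_sign (levelStab_normal c n) le_rfl (transitive_levelRoots hb hns n)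
    (exists_map_levelProd_ne hb hns (exists_prod_eq_sq_of_fixed hb hns n
      fun m _ => transitive_levelRoots hb hns m)) ε hε

end Quadratic

end Arboreal
end

/-! ### Products of square roots as values of the iterates -/

noncomputable section

namespace Arboreal

/-- `hc` makes the iterates separable: the two square roots above `α` coincide only if `α` is `c n`,
which `hc` forbids. So a product over a finite set counts every root correctly. -/
theorem prod_sub_levelRoots {K E : Type*} [Field K] [Field E] [Algebra K E] [IsAlgClosed E]
    [CharZero E] {c : ℕ → K}
    (hc : ∀ n, (rightIterate (fun n => X ^ 2 + C (c n)) n).eval (c n) ≠ 0) (n : ℕ) (x : E) :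
    ∏ α ∈ levelRoots E c n, (x - α) = aeval x (rightIterate (fun n => X ^ 2 + C (c n)) n) := by
  classical
  induction n generalizing x with
  | zero => simp [levelRoots, rightIterate]
  | succ n ih =>
    rw [levelRoots, Finset.prod_biUnion]
    · have h : ∀ α ∈ levelRoots E c n,
          ∏ β ∈ ({sqrtOf (α - algebraMap K E (c n)), -sqrtOf (α - algebraMap K E (c n))} : Finset E),
            (x - β) = (x ^ 2 + algebraMap K E (c n)) - α := by
        intro α hα
        rw [Finset.prod_pair]
        · linear_combination -sqrtOf_sq (α - algebraMap K E (c n))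
        · intro h0
          have h1 := sqrtOf_sq (α - algebraMap K E (c n))
          rw [self_eq_neg.1 h0, zero_pow two_ne_zero, eq_comm, sub_eq_zero] at h1
          rw [mem_levelRoots_iff, h1, aeval_algebraMap_apply] at hα
          apply hc n
          simpa [coe_aeval_eq_eval] using hα
      rw [Finset.prod_congr rfl h, ih]
      simp [rightIterate, aeval_comp]
    · have hsq : ∀ α β : E, β ∈ ({sqrtOf (α - algebraMap K E (c n)),
          -sqrtOf (α - algebraMap K E (c n))} : Finset E) → α = β ^ 2 + algebraMap K E (c n) := by
        intro α β h
        rw [Finset.mem_insert, Finset.mem_singleton, ← sq_eq_sq_iff_eq_or_eq_neg, sqrtOf_sq] at h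
        rw [h, sub_add_cancel]
      intro α _ α' _ hne
      refine Finset.disjoint_left.2 fun β hβ hβ' => hne ?_
      rw [hsq α β hβ, ← hsq α' β hβ']

theorem levelProd_sq {K E : Type*} [Field K] [Field E] [Algebra K E] [IsAlgClosed E]
    [CharZero E] {c : ℕ → K}
    (hc : ∀ n, (rightIterate (fun n => X ^ 2 + C (c n)) n).eval (c n) ≠ 0) (n : ℕ) :
    levelProd E c n ^ 2 = algebraMap K E ((-1) ^ (levelRoots E c n).card *
      (rightIterate (fun n => X ^ 2 + C (c n)) n).eval (c n)) := by
  have h := prod_sub_levelRoots (E := E) hc n (algebraMap K E (c n))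
  rw [aeval_algebraMap_apply, coe_aeval_eq_eval] at h
  rw [map_mul, ← h, levelProd, ← Finset.prod_pow, map_pow, map_neg, map_one, ← Finset.prod_const,
    ← Finset.prod_mul_distrib]
  exact Finset.prod_congr rfl fun α _ => by rw [sqrtOf_sq]; ring

theorem rightIterate_monic {K : Type*} [Field K] (c : ℕ → K) (n : ℕ) :
    (rightIterate (fun n => X ^ 2 + C (c n)) n).Monic := by
  induction n with
  | zero => exact monic_X
  | succ n ih =>
    refine ih.comp (monic_X_pow_add_C _ two_ne_zero) ?_
    rw [natDegree_X_pow_add_C]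
    exact two_ne_zero

theorem mem_rootSet_iff_mem_levelRoots {K : Type*} [Field K] {c : ℕ → K} {n : ℕ}
    {α : AlgebraicClosure K} :
    α ∈ (rightIterate (fun n => X ^ 2 + C (c n)) n).rootSet (AlgebraicClosure K) ↔
      α ∈ levelRoots (AlgebraicClosure K) c n := by
  rw [mem_rootSet, mem_levelRoots_iff]
  exact and_iff_right (rightIterate_monic c n).ne_zero

/-- Distinct right iterates have no common roots when all sign changes are realized. -/
theorem eq_of_mem_levelRoots {K E : Type*} [Field K] [Field E] [Algebra K E] [IsAlgClosed E]
    [CharZero E] {c : ℕ → K} (hne : ∀ n, levelProd E c n ≠ 0)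
    (hsign : ∀ (n : ℕ) (ε : E → E), (∀ α, ε α = 1 ∨ ε α = -1) →
      ∃ σ ∈ levelStab E c n, ∀ α ∈ levelRoots E c n,
        σ (sqrtOf (α - algebraMap K E (c n))) = ε α * sqrtOf (α - algebraMap K E (c n)))
    {m n : ℕ} {α : E} (hm : α ∈ levelRoots E c m) (hn : α ∈ levelRoots E c n) : m = n := by
  have key : ∀ {m n : ℕ}, m < n → α ∈ levelRoots E c m → α ∈ levelRoots E c n → False := by
    intro m n hmn hm hn
    obtain ⟨n, rfl⟩ : ∃ k, n = k + 1 := ⟨n - 1, by lia⟩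
    -- This `σ` fixes level `n`, and so all lower levels including that of `α`, yet negates every
    -- nonzero root of level `n + 1`.
    obtain ⟨σ, hσ, h⟩ := hsign n (fun _ => -1) (fun _ => Or.inr rfl)
    have h1 := levelStab_antitone c (Nat.lt_succ_iff.1 hmn) hσ α hm
    have h2 := mem_levelRoots_succ.1 hn
    have h3 := h _ h2
    have h4 := Finset.prod_ne_zero_iff.1 (hne n) _ h2
    have h5 : σ (sqrtOf (α ^ 2 + algebraMap K E (c n) - algebraMap K E (c n))) =
        sqrtOf (α ^ 2 + algebraMap K E (c n) - algebraMap K E (c n)) := by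
      rcases eq_or_eq_neg_sqrtOf (c := c) (n := n) α with h6 | h6
      · rw [← h6, h1]
      · rw [← neg_eq_iff_eq_neg] at h6
        rw [← h6, map_neg, h1]
    rw [h5, neg_one_mul] at h3
    exact h4 (self_eq_neg.1 h3)
  rcases lt_trichotomy m n with h | h | h
  · exact (key h hm hn).elim
  · exact h
  · exact (key h hn hm).elim

/-! ### Automorphisms of the preimage tree -/

section Tree

variable {K : Type*} [Field K] {c : ℕ → K}

local notation "Γ" => fun n => X ^ 2 + C (c n)
local notation "Ω" => AlgebraicClosure K

/-- The vertex of the preimage tree given by a root of a right iterate. -/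
def vertexOf {n : ℕ} {α : Ω} (h : α ∈ levelRoots Ω c n) : Vertex Γ :=
  ⟨α, n, mem_rootSet_iff_mem_levelRoots.2 h⟩

theorem exists_mem_levelRoots (u : Vertex Γ) : ∃ n, u.1 ∈ levelRoots Ω c n :=
  u.2.imp fun _ h => mem_rootSet_iff_mem_levelRoots.1 h

/-- The inequality of endpoints built into `SimpleGraph.fromRel` is automatic, since parent and
child lie on different levels. -/
theorem adj_iff (hlev : ∀ {m n : ℕ} {α : Ω}, α ∈ levelRoots Ω c m → α ∈ levelRoots Ω c n → m = n)
    {u v : Vertex Γ} : (preimageTree Γ).Adj u v ↔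
      (∃ m, u.1 ∈ levelRoots Ω c (m + 1) ∧ u.1 ^ 2 + algebraMap K Ω (c m) = v.1) ∨
      ∃ m, v.1 ∈ levelRoots Ω c (m + 1) ∧ v.1 ^ 2 + algebraMap K Ω (c m) = u.1 := by
  rw [preimageTree, SimpleGraph.fromRel_adj]
  simp only [mem_rootSet_iff_mem_levelRoots, map_add, map_pow, aeval_X, aeval_C]
  refine and_iff_right_of_imp ?_
  rintro (⟨m, h1, h2⟩ | ⟨m, h1, h2⟩) rfl
  all_goals
    have h3 := mem_levelRoots_succ.1 h1
    rw [h2] at h3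
    have := hlev h1 h3
    lia

theorem algEquiv_eq_on_levelField {γ : ℕ → K[X]} {n : ℕ} {σ τ : Ω ≃ₐ[K] Ω}
    (h : ∀ α ∈ (rightIterate γ n).rootSet Ω, σ α = τ α) {x : Ω} (hx : x ∈ levelField γ n) :
    σ x = τ x := by
  induction hx using IntermediateField.adjoin_induction with
  | mem x hx => exact h x hx
  | algebraMap x => rw [σ.commutes, τ.commutes]
  | add x y _ _ hx hy => rw [map_add, map_add, hx, hy]
  | inv x _ hx => rw [map_inv₀, map_inv₀, hx]
  | mul x y _ _ hx hy => rw [map_mul, map_mul, hx, hy]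

theorem restrictNormal_levelField_val {γ : ℕ → K[X]} {n : ℕ} (σ : Ω ≃ₐ[K] Ω)
    (x : levelField γ n) : (σ.restrictNormal (levelField γ n) x : Ω) = σ x :=
  σ.restrictNormal_commutes (levelField γ n) x

/-- The arboreal representation is faithful. -/
theorem arborealRep_injective (γ : ℕ → K[X]) : Function.Injective (arborealRep γ) := by
  rw [injective_iff_map_eq_one]
  intro σ hσ
  apply Subtype.ext
  funext n
  apply AlgEquiv.ext
  intro ⟨x, hx⟩
  have h := algEquiv_eq_on_levelField (γ := γ) (n := n) (τ := 1)
    (σ := (σ.1 n).liftNormal Ω) ?_ hx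
  · apply Subtype.ext
    exact ((σ.1 n).liftNormal_commutes Ω ⟨x, hx⟩).symm.trans h
  · intro α hα
    have h1 := vertexMap_val σ ⟨α, n, hα⟩ n (mem_levelField hα)
    have h2 : vertexMap σ ⟨α, n, hα⟩ = ⟨α, n, hα⟩ := DFunLike.congr_fun hσ _
    rw [h2] at h1
    exact ((σ.1 n).liftNormal_commutes Ω ⟨α, mem_levelField hα⟩).trans h1.symm

variable [CharZero K]

/-- The root has at most two neighbours, whereas a vertex of positive level has three: its parent
`p` and its children `s` and `s'`. Pulled back by `φ`, these three would all be square roots of the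
same element. -/
theorem treeAut_root
    (hlev : ∀ {m n : ℕ} {α : Ω}, α ∈ levelRoots Ω c m → α ∈ levelRoots Ω c n → m = n)
    (φ : TreeAut Γ) (u : Vertex Γ) (hu : u.1 ∈ levelRoots Ω c 0) :
    (φ u).1 ∈ levelRoots Ω c 0 := by
  obtain ⟨m, hm⟩ := exists_mem_levelRoots (φ u)
  rcases m with _ | m
  · exact hm
  exfalso
  set w := φ u
  let p : Vertex Γ := vertexOf (mem_levelRoots_succ.1 hm)
  let s : Vertex Γ := vertexOf (sqrtOf_mem_levelRoots hm)
  let s' : Vertex Γ := vertexOf (neg_mem_levelRoots_succ (sqrtOf_mem_levelRoots hm))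
  have hs2 : s.1 ^ 2 + algebraMap K Ω (c (m + 1)) = w.1 := by
    change sqrtOf _ ^ 2 + _ = _
    rw [sqrtOf_sq, sub_add_cancel]
  have hs : s.1 ∈ levelRoots Ω c (m + 2) := sqrtOf_mem_levelRoots hm
  have hs' : s'.1 ∈ levelRoots Ω c (m + 2) :=
    neg_mem_levelRoots_succ (sqrtOf_mem_levelRoots hm)
  have hp : p.1 ∈ levelRoots Ω c m := mem_levelRoots_succ.1 hm
  have hsq : ∀ v, (preimageTree Γ).Adj w v → (φ.symm v).1 ^ 2 + algebraMap K Ω (c 0) = u.1 := by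
    intro v hv
    have h1 : (preimageTree Γ).Adj u (φ.symm v) := by
      rw [← φ.map_adj_iff, φ.apply_symm_apply]
      exact hv
    rcases (adj_iff hlev).1 h1 with ⟨k, h2, -⟩ | ⟨k, h2, h3⟩
    · exact absurd (hlev h2 hu) k.succ_ne_zero
    · have h4 := mem_levelRoots_succ.1 h2
      rw [h3] at h4
      rwa [hlev h4 hu] at h3
  have h1 := hsq p ((adj_iff hlev).2 (Or.inl ⟨m, hm, rfl⟩))
  have h2 := hsq s ((adj_iff hlev).2 (Or.inr ⟨m + 1, hs, hs2⟩))
  have h3 := hsq s' ((adj_iff hlev).2 (Or.inr ⟨m + 1, hs', by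
    rw [← hs2]; congr 1; exact neg_sq _⟩))
  have hps : p ≠ s := by
    intro h
    rw [h] at hp
    have := hlev hp hs
    lia
  have hps' : p ≠ s' := by
    intro h
    rw [h] at hp
    have := hlev hp hs'
    lia
  have hss' : s ≠ s' := by
    intro h
    have h4 : s.1 = -s.1 := congrArg Subtype.val h
    rw [self_eq_neg.1 h4] at hs
    exact absurd (hlev hs (mem_levelRoots_zero.2 rfl)) (by lia)
  have h4 := sq_eq_sq_iff_eq_or_eq_neg.1 (add_right_cancel (h1.trans h2.symm))
  have h5 := sq_eq_sq_iff_eq_or_eq_neg.1 (add_right_cancel (h1.trans h3.symm))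
  have inj : ∀ {x y : Vertex Γ}, (φ.symm x).1 = (φ.symm y).1 → x = y :=
    fun h => φ.symm.injective (Subtype.ext h)
  rcases h4 with h4 | h4
  · exact hps (inj h4)
  rcases h5 with h5 | h5
  · exact hps' (inj h5)
  exact hss' (inj (neg_injective (h4.symm.trans h5)))

/-- Automorphisms of the preimage tree preserve levels and commute with passing to the parent. -/
theorem treeAut_level
    (hlev : ∀ {m n : ℕ} {α : Ω}, α ∈ levelRoots Ω c m → α ∈ levelRoots Ω c n → m = n)
    (φ : TreeAut Γ) (m : ℕ) :
    (∀ u : Vertex Γ, u.1 ∈ levelRoots Ω c m → (φ u).1 ∈ levelRoots Ω c m) ∧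
    ∀ u p : Vertex Γ, u.1 ∈ levelRoots Ω c (m + 1) → u.1 ^ 2 + algebraMap K Ω (c m) = p.1 →
      (φ u).1 ∈ levelRoots Ω c (m + 1) ∧ (φ u).1 ^ 2 + algebraMap K Ω (c m) = (φ p).1 := by
  -- Adjacency is symmetric, so it only has to be excluded that `φ` turns a parent into a child of
  -- its own child.
  have step : ∀ m, (∀ u : Vertex Γ, u.1 ∈ levelRoots Ω c m → (φ u).1 ∈ levelRoots Ω c m) →
      (∀ u p : Vertex Γ, u.1 ∈ levelRoots Ω c (m + 1) → u.1 ^ 2 + algebraMap K Ω (c m) = p.1 →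
        ∀ k, (φ p).1 ∈ levelRoots Ω c (k + 1) → (φ p).1 ^ 2 + algebraMap K Ω (c k) = (φ u).1 → False) →
      ∀ u p : Vertex Γ, u.1 ∈ levelRoots Ω c (m + 1) → u.1 ^ 2 + algebraMap K Ω (c m) = p.1 →
        (φ u).1 ∈ levelRoots Ω c (m + 1) ∧ (φ u).1 ^ 2 + algebraMap K Ω (c m) = (φ p).1 := by
    intro m h1 h2 u p hu hup
    have hp : p.1 ∈ levelRoots Ω c m := by
      rw [← hup]
      exact mem_levelRoots_succ.1 hu
    have hadj : (preimageTree Γ).Adj (φ u) (φ p) :=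
      φ.map_adj_iff.2 ((adj_iff hlev).2 (Or.inl ⟨m, hu, hup⟩))
    rcases (adj_iff hlev).1 hadj with ⟨k, h3, h4⟩ | ⟨k, h3, h4⟩
    · have h5 := mem_levelRoots_succ.1 h3
      rw [h4] at h5
      obtain rfl := hlev h5 (h1 p hp)
      exact ⟨h3, h4⟩
    · exact (h2 u p hu hup k h3 h4).elim
  induction m with
  | zero =>
    refine ⟨treeAut_root hlev φ, step 0 (treeAut_root hlev φ) fun u p hu hup k hk _ => ?_⟩
    have hp : p.1 ∈ levelRoots Ω c 0 := by
      rw [← hup]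
      exact mem_levelRoots_succ.1 hu
    exact k.succ_ne_zero (hlev hk (treeAut_root hlev φ p hp))
  | succ m ih =>
    have h1 : ∀ u : Vertex Γ, u.1 ∈ levelRoots Ω c (m + 1) →
        (φ u).1 ∈ levelRoots Ω c (m + 1) := fun u hu =>
      (ih.2 u (vertexOf (mem_levelRoots_succ.1 hu)) hu rfl).1
    refine ⟨h1, step _ h1 fun u p hu hup k hk h => ?_⟩
    have hp : p.1 ∈ levelRoots Ω c (m + 1) := by
      rw [← hup]
      exact mem_levelRoots_succ.1 hu
    obtain rfl : k = m := Nat.succ_injective (hlev hk (h1 p hp))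
    have hq := (ih.2 p (vertexOf (mem_levelRoots_succ.1 hp)) hp rfl).2
    -- If `φ u` were the parent of `φ p`, it would be the image of the parent of `p`. Then `u` would
    -- be that parent, two levels too low.
    have huq := φ.injective (Subtype.ext (h.symm.trans hq))
    rw [huq] at hu
    have := hlev hu (mem_levelRoots_succ.1 hp)
    lia

/-- On finitely many levels every automorphism of the preimage tree is given by an automorphism of
the algebraic closure. -/
theorem exists_algEquiv_eq_treeAut
    (hlev : ∀ {m n : ℕ} {α : Ω}, α ∈ levelRoots Ω c m → α ∈ levelRoots Ω c n → m = n)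
    (hsign : ∀ (n : ℕ) (ε : Ω → Ω), (∀ α, ε α = 1 ∨ ε α = -1) →
      ∃ σ ∈ levelStab Ω c n, ∀ α ∈ levelRoots Ω c n,
        σ (sqrtOf (α - algebraMap K Ω (c n))) = ε α * sqrtOf (α - algebraMap K Ω (c n)))
    (φ : TreeAut Γ) (n : ℕ) :
    ∃ σ : Ω ≃ₐ[K] Ω, ∀ m ≤ n, ∀ u : Vertex Γ, u.1 ∈ levelRoots Ω c m → σ u.1 = (φ u).1 := by
  induction n with
  | zero =>
    refine ⟨1, fun m hm u hu => ?_⟩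
    obtain rfl := Nat.le_zero.1 hm
    have := treeAut_root hlev φ u hu
    rw [mem_levelRoots_zero] at hu this
    rw [hu, this, map_zero]
  | succ n ih =>
    obtain ⟨σ, hσ⟩ := ih
    have hpar := (treeAut_level hlev φ n).2
    -- `φ` and `σ` agree on the parent `α`, so on the chosen square root above it they differ by a
    -- sign. This sign is the one that `τ` has to realize.
    have hε : ∀ α, ∃ x : Ω, (x = 1 ∨ x = -1) ∧ ∀ h : α ∈ levelRoots Ω c n,
        (φ (vertexOf (sqrtOf_mem_levelRoots h))).1 = x * σ (sqrtOf (α - algebraMap K Ω (c n))) := by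
      intro α
      by_cases hα : α ∈ levelRoots Ω c n
      · have h1 := (hpar (vertexOf (sqrtOf_mem_levelRoots hα)) (vertexOf hα)
          (sqrtOf_mem_levelRoots hα) (by
            change sqrtOf _ ^ 2 + _ = α
            rw [sqrtOf_sq, sub_add_cancel])).2
        rw [← hσ n le_rfl (vertexOf hα) hα] at h1
        have h2 : (φ (vertexOf (sqrtOf_mem_levelRoots hα))).1 ^ 2 =
            σ (sqrtOf (α - algebraMap K Ω (c n))) ^ 2 := by
          rw [← map_pow, sqrtOf_sq, map_sub, σ.commutes]
          exact eq_sub_of_add_eq h1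
        rcases sq_eq_sq_iff_eq_or_eq_neg.1 h2 with h3 | h3
        · exact ⟨1, Or.inl rfl, fun _ => by rw [h3, one_mul]⟩
        · exact ⟨-1, Or.inr rfl, fun _ => by rw [h3, neg_one_mul]⟩
      · exact ⟨1, Or.inl rfl, fun h => absurd h hα⟩
    choose ε hε1 hε2 using hε
    obtain ⟨τ, hτ, hτε⟩ := hsign n ε hε1
    -- `τ` acts first and fixes all levels up to `n`, so it does not disturb what `σ` already does
    -- there.
    refine ⟨σ * τ, fun m hm u hu => ?_⟩
    rw [AlgEquiv.mul_apply]
    rcases Nat.le_succ_iff.1 hm with hm | rfl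
    · rw [levelStab_antitone c hm hτ _ hu, hσ m hm u hu]
    have hα := mem_levelRoots_succ.1 hu
    set α := u.1 ^ 2 + algebraMap K Ω (c n)
    set r : Vertex Γ := vertexOf (sqrtOf_mem_levelRoots hα)
    have hr1 : r.1 = sqrtOf (α - algebraMap K Ω (c n)) := rfl
    have hr2 : σ (τ r.1) = (φ r).1 := by
      rw [hε2 α hα, hr1, hτε α hα, map_mul]
      rcases hε1 α with h | h <;> simp [h]
    by_cases hur : u = r
    · rw [hur, hr2]
    have hneg : u.1 = -r.1 := by
      rcases eq_or_eq_neg_sqrtOf (c := c) (n := n) u.1 with h | h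
      · exact absurd (Subtype.ext h) hur
      · exact h
    have h1 := (hpar u (vertexOf hα) hu rfl).2
    have h2 := (hpar r (vertexOf hα) (sqrtOf_mem_levelRoots hα) (by
      rw [hr1, sqrtOf_sq, sub_add_cancel]; rfl)).2
    rcases sq_eq_sq_iff_eq_or_eq_neg.1 (add_right_cancel (h1.trans h2.symm)) with h | h
    · exact absurd (φ.injective (Subtype.ext h)) hur
    · rw [h, hneg, map_neg, map_neg, hr2]

/-- The automorphisms chosen for different `n` need not agree on the whole closure. Their
restrictions are compatible because a level field is generated by roots, on which they all act as
`φ`. -/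
theorem arborealRep_surjective
    (hlev : ∀ {m n : ℕ} {α : Ω}, α ∈ levelRoots Ω c m → α ∈ levelRoots Ω c n → m = n)
    (hsign : ∀ (n : ℕ) (ε : Ω → Ω), (∀ α, ε α = 1 ∨ ε α = -1) →
      ∃ σ ∈ levelStab Ω c n, ∀ α ∈ levelRoots Ω c n,
        σ (sqrtOf (α - algebraMap K Ω (c n))) = ε α * sqrtOf (α - algebraMap K Ω (c n))) :
    Function.Surjective (arborealRep Γ) := by
  intro φ
  choose σ hσ using exists_algEquiv_eq_treeAut hlev hsign φ
  refine ⟨⟨fun n => (σ n).restrictNormal (levelField Γ n), fun m n hmn x y hxy => ?_⟩, ?_⟩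
  · rw [restrictNormal_levelField_val, restrictNormal_levelField_val, ← hxy]
    refine algEquiv_eq_on_levelField (γ := Γ) (n := m) (fun α hα => ?_) x.2
    have hα' := mem_rootSet_iff_mem_levelRoots.1 hα
    rw [hσ m m le_rfl ⟨α, m, hα⟩ hα', hσ n m hmn ⟨α, m, hα⟩ hα']
  · refine RelIso.ext fun u => Subtype.ext ?_
    obtain ⟨n, hn⟩ := u.2
    refine (vertexMap_val _ u n (mem_levelField hn)).trans ?_
    exact (restrictNormal_levelField_val _ _).trans
      (hσ n n le_rfl u (mem_rootSet_iff_mem_levelRoots.1 hn))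

/-- The arboreal representation of a sequence `X ^ 2 + c n` is bijective if the values
`θ₁ ∘ ⋯ ∘ θₙ (c n)` are, up to sign, multiplicatively independent modulo squares. -/
theorem arborealRep_bijective
    (h : ∀ I : Finset ℕ, I.Nonempty → ∀ (k : ℕ) (s : K),
      (-1) ^ k * ∏ i ∈ I, (rightIterate Γ i).eval (c i) ≠ s ^ 2) :
    Function.Bijective (arborealRep Γ) := by
  have hc : ∀ n, (rightIterate Γ n).eval (c n) ≠ 0 := fun n h0 =>
    h {n} (Finset.singleton_nonempty n) 0 0 (by simp [h0])
  have hb := levelProd_sq (E := Ω) hc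
  have hns : ∀ I : Finset ℕ, I.Nonempty → ∀ s : K,
      ∏ i ∈ I, ((-1) ^ (levelRoots Ω c i).card * (rightIterate Γ i).eval (c i)) ≠ s ^ 2 := by
    intro I hI s
    -- The signs collect into one power of `-1`, absorbed by the arbitrary exponent `k` in `h`.
    rw [Finset.prod_mul_distrib, Finset.prod_pow_eq_pow_sum]
    exact h I hI _ s
  have hsign := exists_sign_levelStab hb hns
  have hne : ∀ n, levelProd Ω c n ≠ 0 := by
    intro n h0
    have h1 := hb n
    rw [h0, zero_pow two_ne_zero, eq_comm, map_eq_zero, mul_eq_zero] at h1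
    exact h1.elim (pow_ne_zero _ (neg_ne_zero.2 one_ne_zero)) (hc n)
  exact ⟨arborealRep_injective Γ,
    arborealRep_surjective (fun hm hn => eq_of_mem_levelRoots hne hsign hm hn) hsign⟩

end Tree

/-! ### Derivatives and degrees of the iterated values -/

section Reduction

/-- The polynomial `θ₁ ∘ ⋯ ∘ θₙ (p)` for `θᵢ₊₁ = X ^ 2 + a i` with integral coefficients `a i`. -/
def iterateValue {R : Type*} [CommRing R] (a : ℕ → R) : ℕ → R → R
  | 0, p => p
  | n + 1, p => iterateValue a n (p ^ 2 + a n)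

theorem map_iterateValue {R S : Type*} [CommRing R] [CommRing S] (f : R →+* S) (a : ℕ → R) (n : ℕ)
    (p : R) : f (iterateValue a n p) = iterateValue (fun i => f (a i)) n (f p) := by
  induction n generalizing p with
  | zero => rfl
  | succ n ih => simp [iterateValue, ih]

theorem eval_rightIterate {K : Type*} [Field K] (c : ℕ → K) (n : ℕ) (x : K) :
    (rightIterate (fun n => X ^ 2 + C (c n)) n).eval x = iterateValue c n x := by
  induction n generalizing x with
  | zero => simp [rightIterate, iterateValue]
  | succ n ih => simp [rightIterate, iterateValue, eval_comp, ih]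

/-- In characteristic 2 the derivative of `p ^ 2 + a n` is that of `a n`, so derivative `1` survives
each step. -/
theorem derivative_iterateValue {a : ℕ → (ZMod 2)[X]} (ha : ∀ n, derivative (a n) = 1) (n : ℕ)
    {p : (ZMod 2)[X]} (hp : derivative p = 1) : derivative (iterateValue a n p) = 1 := by
  induction n generalizing p with
  | zero => exact hp
  | succ n ih =>
    refine ih ?_
    rw [derivative_add, derivative_sq, ha, show (2 : ZMod 2) = 0 from rfl, C_0]
    simp

/-- As `d` is positive and at most the degree of `p`, the square dominates `a n`, and each step
doubles the degree. -/
theorem natDegree_iterateValue {F : Type*} [Field F] {d : ℕ} (hd : 0 < d) {a : ℕ → F[X]}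
    (ha : ∀ n, (a n).natDegree = d) (n : ℕ) {p : F[X]} (hp : d ≤ p.natDegree) :
    (iterateValue a n p).natDegree = 2 ^ n * p.natDegree := by
  induction n generalizing p with
  | zero => simp [iterateValue]
  | succ n ih =>
    have h : (p ^ 2 + a n).natDegree = 2 * p.natDegree := by
      rw [natDegree_add_eq_left_of_natDegree_lt, natDegree_pow]
      rw [natDegree_pow, ha]
      lia
    rw [iterateValue, ih (by rw [h]; lia), h, pow_succ, mul_assoc]

end Reduction

end Arboreal

end

theorem mainTheorem11 (d : ℕ) (hd : 0 < d) (S : Set (RatFunc ℚ)[X])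
    (hS : ∀ f ∈ S, ∃ c : ℤ[X],
      f = X ^ 2 + C (algebraMap ℚ[X] (RatFunc ℚ) (c.map (Int.castRingHom ℚ))) ∧
      (c.leadingCoeff = 1 ∨ c.leadingCoeff = -1) ∧
      c.natDegree = d ∧
      derivative (c.map (Int.castRingHom (ZMod 2))) = 1)
    (γ : ℕ → (RatFunc ℚ)[X]) (hγ : ∀ n, γ n ∈ S) :
    Function.Bijective (Arboreal.arborealRep γ) := by
  choose a ha hlead hdeg hder using fun n => hS (γ n) (hγ n)
  let f : ℤ[X] →+* RatFunc ℚ :=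
    (algebraMap ℚ[X] (RatFunc ℚ)).comp (mapRingHom (Int.castRingHom ℚ))
  let ρ : ℤ[X] →+* (ZMod 2)[X] := mapRingHom (Int.castRingHom (ZMod 2))
  obtain rfl : γ = fun n => X ^ 2 + C (f (a n)) := funext ha
  refine Arboreal.arborealRep_bijective (c := fun n => f (a n)) fun I hI k s h => ?_
  simp_rw [Arboreal.eval_rightIterate, ← Arboreal.map_iterateValue f] at h
  have h1 : f ((-1) ^ k * ∏ i ∈ I, Arboreal.iterateValue a i (a i)) = s ^ 2 := by
    rw [← h]
    simp
  refine algebraMap_map_ne_sq_of_derivative_map_ne_zero ?_ s h1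
  change derivative (ρ _) ≠ 0
  -- A leading coefficient `±1` is nonzero modulo 2, so reduction keeps the degree `d`.
  have hdeg2 : ∀ n, (ρ (a n)).natDegree = d := fun n => by
    rw [← hdeg n]
    refine natDegree_map_of_leadingCoeff_ne_zero _ ?_
    rcases hlead n with h | h <;> simp [h]
  -- The degrees are `2 ^ i * d`, distinct because `d` is positive.
  have key := derivative_prod_ne_zero_of_derivative_eq_one
    (fun i => Arboreal.iterateValue (fun j => ρ (a j)) i (ρ (a i)))
    (fun i => Arboreal.derivative_iterateValue hder i (hder i)) (fun i j hij => by
      simp only [Arboreal.natDegree_iterateValue hd hdeg2 _ (hdeg2 _).ge, hdeg2] at hij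
      exact Nat.pow_right_injective le_rfl (Nat.eq_of_mul_eq_mul_right hd hij)) hI
  rw [map_mul, map_pow, map_neg, map_one, map_prod]
  simp_rw [Arboreal.map_iterateValue ρ]
  rcases neg_one_pow_eq_or (ZMod 2)[X] k with h | h <;> rw [h]
  · rwa [one_mul]
  · rwa [neg_one_mul, derivative_neg, neg_ne_zero]
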